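/- An $r$-graph (a finite hypergraph all of whose edges have exactly $r$ vertices) is called complete linear if every pair of distinct vertices belongs to exactly one edge. A $(v,k)$-configuration is a set of $k$ distinct edges whose union has at most $v$ vertices; given a colouring of the edges, it is monochromatic if its edges all have the same colour. For any integers $r \ge 4$ and $k \ge 3$ there exists $n_0 = n_0(r,k)$ such that for every $n > n_0$, every colouring of the edges of a complete linear $r$-graph on $n$ vertices with $2$ colours contains a monochromatic $((r-2)k+3,\,k)$-configuration. -/

import Mathlib

namespace Hypergraph

/-- An `r`-graph: every edge contains precisely `r` vertices. -/
def IsRGraph {α : Type*} (G : Hypergraph α) (r : ℕ) : Prop :=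
  ∀ e ∈ G.edgeSet, e.encard = r

/-- A linear `r`-graph: every pair of distinct vertices belongs to at most one edge. -/
def IsLinearRGraph {α : Type*} (G : Hypergraph α) (r : ℕ) : Prop :=
  G.IsRGraph r ∧ ∀ x ∈ G.vertexSet, ∀ y ∈ G.vertexSet, x ≠ y →
    ∀ e ∈ G.edgeSet, ∀ f ∈ G.edgeSet, x ∈ e → y ∈ e → x ∈ f → y ∈ f → e = f

/-- A complete linear `r`-graph: a linear `r`-graph in which every pair of distinct vertices
belongs to an edge (hence to exactly one). -/
def IsCompleteLinearRGraph {α : Type*} (G : Hypergraph α) (r : ℕ) : Prop :=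
  G.IsLinearRGraph r ∧ ∀ x ∈ G.vertexSet, ∀ y ∈ G.vertexSet, x ≠ y →
    ∃ e ∈ G.edgeSet, x ∈ e ∧ y ∈ e

/-- A `(v, k)`-configuration in `G`: a set of exactly `k` edges of `G` whose union has at most
`v` vertices. -/
def IsConfiguration {α : Type*} (G : Hypergraph α) (v k : ℕ) (F : Set G.edgeSet) : Prop :=
  F.encard = k ∧ (⋃ e ∈ F, (e : Set α)).encard ≤ v

/-- A set of edges is monochromatic under a colouring of the edges: all its members receive one
and the same colour. -/
def IsMonochromatic {α : Type*} (G : Hypergraph α) {C : Type*} (χ : G.edgeSet → C)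
    (F : Set G.edgeSet) : Prop :=
  ∃ c : C, ∀ e ∈ F, χ e = c

end Hypergraph

/-!
Every vertex has the same degree `D = (n - 1) / (r - 1)`. If `a` and `b` of the edges at a vertex
have the two colours, then `a² + b² ≥ D² / 2`; averaging this over all vertices produces an edge `e`
whose `r` vertices lie, in total, on at least `r * D / 2` edges of the colour of `e`
(`exists_mul_le_two_mul_sum_card_filter`).

Let `H` be the set of edges other than `e` that have the colour of `e` and meet `e`. Each of them
has `r - 1` vertices outside `e`, so `j` of them span together with `e` at most `(r - 2)(j + 1) + 3`
vertices as soon as their traces outside `e` cover at most `(r - 2) j + 1` points. This is what a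
family of traces that grows like a tree achieves. Up to constants, `H` has
`r n / (2 (r - 1)) > n / (r - 2)` members, where `r ≥ 4` enters, while all traces lie in a set of
fewer than `n` points. Hence the traces cannot split into small tree-like components only, and
`exists_subset_card_biUnion_le` finds `k - 1` suitable ones: it collects minimal families with at
most `r - 2` covered points per member, which cost nothing, and ends with a connected part of
another such family, which costs one extra point.
-/

/-! ### Subfamilies covering few points -/

/-- Call a family dense if it covers at most `d` points per member. A minimal dense family `U` can be
built up set by set, each new set meeting the union of the previous ones: if all remaining sets were
disjoint from that union, the remaining sets would form a smaller dense family. -/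
theorem exists_subset_card_biUnion_le_of_minimal {ι α : Type*} [DecidableEq ι] [DecidableEq α]
    {d : ℕ} (g : ι → Finset α) {U : Finset ι} (hg : ∀ i ∈ U, (g i).card ≤ d + 1)
    (hU : (U.biUnion g).card ≤ d * U.card)
    (hmin : ∀ W ⊂ U, W.Nonempty → d * W.card < (W.biUnion g).card) {s : ℕ} (hs : s ≤ U.card) :
    ∃ S ⊆ U, S.card = s ∧ (S.biUnion g).card ≤ d * s + 1 := by
  induction s with
  | zero => exact ⟨∅, by simp⟩
  | succ s ih =>
    obtain ⟨S, hSU, hScard, hS⟩ := ih (by omega)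
    have hSss : S ⊂ U := by
      refine hSU.ssubset_of_ne ?_
      rintro rfl
      omega
    rcases S.eq_empty_or_nonempty with rfl | hne
    · obtain ⟨i, hi⟩ : U.Nonempty := Finset.card_pos.mp (by omega)
      obtain rfl : s = 0 := by simpa using hScard.symm
      exact ⟨{i}, by simpa using hi, by simp, by simpa using hg i hi⟩
    by_cases hmeet : ∃ i ∈ U \ S, ¬ Disjoint (g i) (S.biUnion g)
    · obtain ⟨i, hi, hmeet⟩ := hmeet
      obtain ⟨hiU, hiS⟩ := Finset.mem_sdiff.mp hi
      refine ⟨insert i S, Finset.insert_subset hiU hSU, ?_, ?_⟩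
      · rw [Finset.card_insert_of_notMem hiS, hScard]
      · have hpos : 0 < (g i ∩ S.biUnion g).card := by
          rw [Finset.card_pos]
          exact Finset.not_disjoint_iff_nonempty_inter.mp hmeet
        have h1 := Finset.card_union_add_card_inter (g i) (S.biUnion g)
        have h2 := hg i hiU
        rw [Finset.biUnion_insert]
        have h3 : d * (s + 1) = d * s + d := by ring
        omega
    · push Not at hmeet
      have hdisj : Disjoint ((U \ S).biUnion g) (S.biUnion g) := by
        rw [Finset.disjoint_biUnion_left]
        exact hmeet
      have hunion : U.biUnion g = (U \ S).biUnion g ∪ S.biUnion g := by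
        rw [← Finset.union_biUnion, Finset.sdiff_union_of_subset hSU]
      rw [hunion, Finset.card_union_of_disjoint hdisj] at hU
      have h1 := hmin S hSss hne
      have h2 := hmin (U \ S) (Finset.sdiff_ssubset hSU hne)
        (Finset.sdiff_nonempty.mpr hSss.not_subset)
      have h3 : (U \ S).card + S.card = U.card := Finset.card_sdiff_add_card_eq_card hSU
      have h4 : d * U.card = d * (U \ S).card + d * S.card := by rw [← h3]; ring
      omega

/-- If a family `H` of sets of size at most `d + 1` covers at most `d * (|H| - s)` points, then some
`s` of its members cover at most `d * s + 1` points. Minimal subfamilies covering at most `d` points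
per member are split off one after the other; the last one is only used in part. -/
theorem exists_subset_card_biUnion_le {ι α : Type*} [DecidableEq ι] [DecidableEq α]
    {d : ℕ} (hd : 0 < d) (g : ι → Finset α) (s : ℕ) (H : Finset ι)
    (hg : ∀ i ∈ H, (g i).card ≤ d + 1) (hH : (H.biUnion g).card + d * s ≤ d * H.card) :
    ∃ S ⊆ H, S.card = s ∧ (S.biUnion g).card ≤ d * s + 1 := by
  induction s using Nat.strong_induction_on generalizing H with
  | _ s ih =>
    rcases Nat.eq_zero_or_pos s with rfl | hs
    · exact ⟨∅, by simp⟩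
    have hHne : H.Nonempty := by
      rw [Finset.nonempty_iff_ne_empty]
      rintro rfl
      simp at hH
      omega
    obtain ⟨U, hUH, hUmin⟩ := exists_minimal_le_of_wellFoundedLT
      (fun W : Finset ι => W.Nonempty ∧ (W.biUnion g).card ≤ d * W.card) H ⟨hHne, by omega⟩
    obtain ⟨hUne, hU⟩ := hUmin.prop
    replace hUH : U ⊆ H := hUH
    rcases le_or_gt s U.card with hsU | hsU
    · obtain ⟨S, hSU, hS⟩ := exists_subset_card_biUnion_le_of_minimal g
        (fun i hi => hg i (hUH hi)) hU (fun W hW hWne => by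
          by_contra! hcon
          exact hW.not_subset (hUmin.le_of_le ⟨hWne, hcon⟩ hW.subset)) hsU
      exact ⟨S, hSU.trans hUH, hS⟩
    · have hUpos := hUne.card_pos
      have h3 : (H \ U).card + U.card = H.card := Finset.card_sdiff_add_card_eq_card hUH
      have h4 : d * H.card = d * (H \ U).card + d * U.card := by rw [← h3]; ring
      have h5 : d * s = d * (s - U.card) + d * U.card := by
        rw [← Nat.mul_add, Nat.sub_add_cancel hsU.le]
      have h6 : ((H \ U).biUnion g).card ≤ (H.biUnion g).card :=
        Finset.card_le_card (Finset.biUnion_subset_biUnion_of_subset_left g Finset.sdiff_subset)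
      obtain ⟨S, hSH, hScard, hS⟩ := ih (s - U.card) (by omega) (H \ U)
        (fun i hi => hg i (Finset.sdiff_subset hi)) (by omega)
      have hdisj : Disjoint S U := Finset.disjoint_of_subset_left hSH Finset.sdiff_disjoint
      refine ⟨S ∪ U, Finset.union_subset (hSH.trans Finset.sdiff_subset) hUH, ?_, ?_⟩
      · rw [Finset.card_union_of_disjoint hdisj]
        omega
      · rw [Finset.union_biUnion]
        have := Finset.card_union_le (S.biUnion g) (U.biUnion g)
        omega

/-! ### Degrees in complete linear hypergraphs -/

/-- In a complete linear `r`-graph the edges through a vertex partition the other vertices, so every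
vertex has degree `(n - 1) / (r - 1)`. -/
theorem card_filter_mem_mul_eq {α : Type*} [DecidableEq α] {V : Finset α} {E : Finset (Finset α)}
    {r : ℕ} (hEV : ∀ e ∈ E, e ⊆ V) (hEr : ∀ e ∈ E, e.card = r)
    (hlin : ∀ e ∈ E, ∀ f ∈ E, e ≠ f → (e ∩ f).card ≤ 1)
    (hcomp : ∀ x ∈ V, ∀ y ∈ V, x ≠ y → ∃ e ∈ E, x ∈ e ∧ y ∈ e) {v : α} (hv : v ∈ V) :
    (E.filter (v ∈ ·)).card * (r - 1) = V.card - 1 := by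
  have hunion : (E.filter (v ∈ ·)).biUnion (·.erase v) = V.erase v := by
    ext w
    simp only [Finset.mem_biUnion, Finset.mem_filter, Finset.mem_erase]
    constructor
    · rintro ⟨e, ⟨he, -⟩, hwv, hwe⟩
      exact ⟨hwv, hEV e he hwe⟩
    · rintro ⟨hwv, hw⟩
      obtain ⟨e, he, h1, h2⟩ := hcomp v hv w hw (Ne.symm hwv)
      exact ⟨e, ⟨he, h1⟩, hwv, h2⟩
  rw [← Finset.card_erase_of_mem hv, ← hunion, Finset.card_biUnion, Finset.sum_const_nat]
  · intro e he
    rw [Finset.mem_filter] at he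
    rw [Finset.card_erase_of_mem he.2, hEr e he.1]
  · intro e he f hf hef
    simp only [Finset.mem_coe, Finset.mem_filter] at he hf
    rw [Function.onFun, Finset.disjoint_left]
    intro w hw1 hw2
    rw [Finset.mem_erase] at hw1 hw2
    exact hw1.1 (Finset.card_le_one.mp (hlin e he.1 f hf.1 hef) w
      (Finset.mem_inter.mpr ⟨hw1.2, hw2.2⟩) v (Finset.mem_inter.mpr ⟨he.2, hf.2⟩))

/-- If all vertices have degree `D`, some edge has vertices whose degrees in the colour of that edge
are at least `D / 2` on average. -/
theorem exists_mul_le_two_mul_sum_card_filter {α : Type*} [DecidableEq α] {V : Finset α}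
    {E : Finset (Finset α)} {r D : ℕ} (χ : Finset α → Fin 2) (hE : E.Nonempty)
    (hEV : ∀ e ∈ E, e ⊆ V) (hEr : ∀ e ∈ E, e.card = r)
    (hD : ∀ v ∈ V, (E.filter (v ∈ ·)).card = D) :
    ∃ e ∈ E, r * D ≤ 2 * ∑ v ∈ e, (E.filter (fun f => v ∈ f ∧ χ f = χ e)).card := by
  by_contra! hcon
  have hswap : ∀ F : Finset α → α → ℕ,
      ∑ e ∈ E, ∑ v ∈ e, F e v = ∑ v ∈ V, ∑ e ∈ E.filter (v ∈ ·), F e v := by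
    intro F
    refine Finset.sum_comm' fun e v => ?_
    simp only [Finset.mem_filter]
    exact ⟨fun h => ⟨⟨h.1, h.2⟩, hEV e h.1 h.2⟩, fun h => h.1⟩
  have hcount : E.card * r = V.card * D := by
    have h := hswap fun _ _ => 1
    simp only [← Finset.card_eq_sum_ones] at h
    rwa [Finset.sum_const_nat hEr, Finset.sum_const_nat hD] at h
  have hlt := Finset.sum_lt_sum_of_nonempty hE hcon
  rw [Finset.sum_const, smul_eq_mul, ← Finset.mul_sum, hswap] at hlt
  -- At a vertex with `a` and `b` edges of the two colours the sum is `a² + b² ≥ (a + b)² / 2`.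
  have hvert : ∀ v ∈ V, D * D ≤ 2 * ∑ e ∈ E.filter (v ∈ ·),
      (E.filter (fun f => v ∈ f ∧ χ f = χ e)).card := by
    intro v hv
    have hsum : ∑ e ∈ E.filter (v ∈ ·), (E.filter (fun f => v ∈ f ∧ χ f = χ e)).card
        = ∑ c : Fin 2, (E.filter (fun f => v ∈ f ∧ χ f = c)).card *
            (E.filter (fun f => v ∈ f ∧ χ f = c)).card := by
      rw [← Finset.sum_fiberwise (E.filter (v ∈ ·)) χ]
      refine Finset.sum_congr rfl fun c _ => ?_
      rw [Finset.filter_filter]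
      refine Finset.sum_const_nat fun e he => ?_
      rw [(Finset.mem_filter.mp he).2.2]
    have hdeg : D = ∑ c : Fin 2, (E.filter (fun f => v ∈ f ∧ χ f = c)).card := by
      rw [← hD v hv, Finset.card_eq_sum_card_fiberwise (f := χ) (t := Finset.univ) (by simp)]
      simp only [Finset.filter_filter]
    rw [hsum]
    rw [Fin.sum_univ_two] at hdeg ⊢
    rw [hdeg]
    zify
    nlinarith [sq_nonneg (((E.filter (fun f => v ∈ f ∧ χ f = 0)).card : ℤ) -
      (E.filter (fun f => v ∈ f ∧ χ f = 1)).card)]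
  have hge := Finset.sum_le_sum hvert
  rw [Finset.sum_const, smul_eq_mul, ← Finset.mul_sum] at hge
  have : E.card * (r * D) = V.card * (D * D) := by rw [← mul_assoc, hcount, mul_assoc]
  omega

/-- Each of the edges counted by `∑ v ∈ e, d(v)` is `e` itself or meets `e` in a single vertex. -/
theorem sum_card_filter_le {α : Type*} [DecidableEq α] {E : Finset (Finset α)} (p : Finset α → Prop)
    [DecidablePred p] (hlin : ∀ e ∈ E, ∀ f ∈ E, e ≠ f → (e ∩ f).card ≤ 1) {e : Finset α}
    (he : e ∈ E) :
    ∑ v ∈ e, (E.filter (fun f => v ∈ f ∧ p f)).card ≤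
      (E.filter (fun f => f ≠ e ∧ p f ∧ (f ∩ e).card = 1)).card + e.card := by
  have hle : ∀ v ∈ e, (E.filter (fun f => v ∈ f ∧ p f)).card ≤
      (E.filter (fun f => f ≠ e ∧ p f ∧ f ∩ e = {v})).card + 1 := by
    intro v hv
    rw [← Finset.card_singleton e]
    refine (Finset.card_le_card fun f hf => ?_).trans (Finset.card_union_le _ _)
    simp only [Finset.mem_union, Finset.mem_filter, Finset.mem_singleton] at hf ⊢
    obtain ⟨hfE, hvf, hpf⟩ := hf
    by_cases hfe : f = e
    · exact Or.inr hfe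
    · refine Or.inl ⟨hfE, hfe, hpf, ?_⟩
      have hmem : v ∈ f ∩ e := Finset.mem_inter.mpr ⟨hvf, hv⟩
      exact Finset.eq_singleton_iff_unique_mem.mpr ⟨hmem, fun w hw =>
        Finset.card_le_one.mp (hlin f hfE e he hfe) w hw v hmem⟩
  refine (Finset.sum_le_sum hle).trans ?_
  rw [Finset.sum_add_distrib, ← Finset.card_eq_sum_ones]
  refine Nat.add_le_add_right ?_ _
  rw [← Finset.card_biUnion]
  · refine Finset.card_le_card fun f hf => ?_
    simp only [Finset.mem_biUnion, Finset.mem_filter] at hf ⊢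
    obtain ⟨v, -, hfE, hfe, hpf, hv⟩ := hf
    exact ⟨hfE, hfe, hpf, by rw [hv, Finset.card_singleton]⟩
  · intro v _ w _ hvw
    rw [Function.onFun, Finset.disjoint_left]
    intro f hf hf'
    simp only [Finset.mem_filter] at hf hf'
    exact hvw (Finset.singleton_injective (hf.2.2.2.symm.trans hf'.2.2.2))

/-! ### Monochromatic configurations -/

/-- The configuration theorem for hypergraphs given by finsets. The bound `4 * r ^ 3 * k` is not
optimized; it only has to absorb the lower-order terms in the count of edges meeting `e`. -/
theorem exists_monochromatic_card_biUnion_le {α : Type*} [DecidableEq α] {V : Finset α}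
    {E : Finset (Finset α)} {r k : ℕ} (hr : 4 ≤ r) (hk : 1 ≤ k) (hV : 4 * r ^ 3 * k < V.card)
    (hEV : ∀ e ∈ E, e ⊆ V) (hEr : ∀ e ∈ E, e.card = r)
    (hlin : ∀ e ∈ E, ∀ f ∈ E, e ≠ f → (e ∩ f).card ≤ 1)
    (hcomp : ∀ x ∈ V, ∀ y ∈ V, x ≠ y → ∃ e ∈ E, x ∈ e ∧ y ∈ e) (χ : Finset α → Fin 2) :
    ∃ S ⊆ E, S.card = k ∧ (S.biUnion id).card ≤ (r - 2) * k + 3 ∧ ∃ c, ∀ e ∈ S, χ e = c := by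
  have hpos : 1 ≤ 4 * r ^ 3 * k := Nat.mul_pos (by positivity) hk
  obtain ⟨x, hx, y, hy, hxy⟩ := Finset.one_lt_card.mp (hpos.trans_lt hV)
  obtain ⟨e₀, he₀, -, -⟩ := hcomp x hx y hy hxy
  have hdeg := fun v hv => card_filter_mem_mul_eq hEV hEr hlin hcomp (v := v) hv
  obtain ⟨D, hD⟩ : ∃ D, D = (E.filter (x ∈ ·)).card := ⟨_, rfl⟩
  have hDn : D * (r - 1) = V.card - 1 := hD ▸ hdeg x hx
  obtain ⟨e, he, hsum⟩ := exists_mul_le_two_mul_sum_card_filter (D := D) χ ⟨e₀, he₀⟩ hEV hEr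
    fun v hv => Nat.eq_of_mul_eq_mul_right (by omega : 0 < r - 1) ((hdeg v hv).trans hDn.symm)
  have hH := sum_card_filter_le (fun f => χ f = χ e) hlin he
  rw [hEr e he] at hH
  obtain ⟨H, hHdef⟩ : ∃ H, H = E.filter (fun f => f ≠ e ∧ χ f = χ e ∧ (f ∩ e).card = 1) := ⟨_, rfl⟩
  rw [← hHdef] at hH
  have hcover : (H.biUnion (· \ e)).card ≤ V.card := by
    refine Finset.card_le_card (Finset.biUnion_subset.mpr fun f hf => ?_)
    rw [hHdef, Finset.mem_filter] at hf
    exact Finset.sdiff_subset.trans (hEV f hf.1)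
  obtain ⟨m, rfl⟩ : ∃ m, r = m + 4 := ⟨r - 4, by omega⟩
  obtain ⟨l, rfl⟩ : ∃ l, k = l + 1 := ⟨k - 1, by omega⟩
  obtain ⟨N, hN⟩ : ∃ N, V.card = N + 1 := ⟨V.card - 1, by omega⟩
  simp only [show m + 4 - 1 = m + 3 by omega, show m + 4 - 2 = m + 2 by omega] at *
  have hmany : V.card + (m + 2) * l ≤ (m + 2) * H.card := by
    have h1 : (m + 4) * D ≤ 2 * (H.card + (m + 4)) := hsum.trans (by omega)
    rw [hN] at hDn hV ⊢
    have h2 : D * (m + 3) = N := by omega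
    -- `r * D ≤ 2 * |H| + 2 * r` with `D = N / (r - 1)`; the leading coefficients compare because
    -- `r * (r - 2) > 2 * (r - 1)` for `r ≥ 4`.
    have h3 : 2 * ((m + 2) * (m + 3) * (m + 4)) + 2 * (m + 3) + 2 * ((m + 3) * (m + 2) * l) ≤ N := by
      have : (m + 2) * (m + 3) * (m + 4) * (l + 1) ≤ (m + 4) ^ 3 * (l + 1) := by
        rw [pow_three']
        gcongr <;> omega
      nlinarith [Nat.zero_le (m ^ 3 * l), Nat.zero_le (m ^ 2 * l), Nat.zero_le (m * l)]
    have h4 := Nat.mul_le_mul_left ((m + 2) * (m + 3)) h1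
    have h5 : (m + 2) * (m + 3) * ((m + 4) * D) = (m + 2) * (m + 4) * N := by rw [← h2]; ring
    rw [h5] at h4
    refine le_of_mul_le_mul_left (a := 2 * (m + 3)) ?_ (by omega)
    nlinarith [Nat.zero_le (m * m * N), Nat.zero_le (m * N)]
  obtain ⟨S, hSH, hScard, hS⟩ := exists_subset_card_biUnion_le (by omega : 0 < m + 2) (· \ e) l H
    (fun f hf => by
      rw [hHdef, Finset.mem_filter] at hf
      have h1 := Finset.card_sdiff_add_card_inter f e
      rw [hf.2.2.2, hEr f hf.1] at h1
      omega) (by omega)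
  have hSE : ∀ f ∈ S, f ∈ E ∧ f ≠ e ∧ χ f = χ e ∧ (f ∩ e).card = 1 := fun f hf => by
    simpa [hHdef] using hSH hf
  refine ⟨insert e S, Finset.insert_subset he fun f hf => (hSE f hf).1, ?_, ?_, χ e, ?_⟩
  · rw [Finset.card_insert_of_notMem fun h => (hSE e h).2.1 rfl, hScard]
  · have hsub : (insert e S).biUnion id ⊆ e ∪ S.biUnion (· \ e) := by
      intro w hw
      obtain ⟨f, hf, hwf⟩ := Finset.mem_biUnion.mp hw
      rw [Finset.mem_union]
      by_cases hwe : w ∈ e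
      · exact Or.inl hwe
      · rcases Finset.mem_insert.mp hf with rfl | hf
        · exact absurd hwf hwe
        · exact Or.inr (Finset.mem_biUnion.mpr ⟨f, hf, Finset.mem_sdiff.mpr ⟨hwf, hwe⟩⟩)
    have h1 := (Finset.card_le_card hsub).trans (Finset.card_union_le _ _)
    rw [hEr e he] at h1
    have h2 : (m + 2) * (l + 1) = (m + 2) * l + (m + 2) := by ring
    omega
  · intro f hf
    rcases Finset.mem_insert.mp hf with rfl | hf
    · rfl
    · exact (hSE f hf).2.2.1

theorem theorem2 (r k : ℕ) (hr : 4 ≤ r) (hk : 3 ≤ k) :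
    ∃ n₀ : ℕ, ∀ n : ℕ, n₀ < n →
      ∀ (α : Type*) (G : Hypergraph α),
        G.vertexSet.encard = n → G.IsCompleteLinearRGraph r →
          ∀ χ : G.edgeSet → Fin 2,
            ∃ F : Set G.edgeSet,
              G.IsConfiguration ((r - 2) * k + 3) k F ∧ G.IsMonochromatic χ F := by
  classical
  -- The edges are finite sets, so `G` and `χ` transfer to a finset `E` of finsets.
  refine ⟨4 * r ^ 3 * k, fun n hn α G hcard hG χ => ?_⟩
  obtain ⟨⟨hunif, hlin⟩, hcomp⟩ := hG
  have hVfin : G.vertexSet.Finite := Set.finite_of_encard_eq_coe hcard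
  obtain ⟨V, hV⟩ := hVfin.exists_finset_coe
  obtain ⟨E, hE⟩ : ∃ E : Finset (Finset α), ∀ e, e ∈ E ↔ (e : Set α) ∈ G.edgeSet := by
    refine ⟨V.powerset.filter fun e => (e : Set α) ∈ G.edgeSet, fun e => ?_⟩
    rw [Finset.mem_filter, Finset.mem_powerset, and_iff_right_iff_imp, ← Finset.coe_subset, hV]
    exact fun he => G.subset_vertexSet_of_mem_edgeSet' he
  have hEV : ∀ e ∈ E, e ⊆ V := fun e he => by
    rw [← Finset.coe_subset, hV]
    exact G.subset_vertexSet_of_mem_edgeSet' ((hE e).mp he)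
  have hmemV : ∀ x, x ∈ V ↔ x ∈ G.vertexSet := fun x => by rw [← hV, Finset.mem_coe]
  have hVcard : V.card = n := by
    rw [← hV, Set.encard_coe_eq_coe_finsetCard] at hcard
    exact_mod_cast hcard
  obtain ⟨S, hSE, hScard, hS, c, hc⟩ := exists_monochromatic_card_biUnion_le
    (V := V) (E := E) (r := r) (k := k) hr (by omega) (by omega) hEV
    (fun e he => by
      have := hunif _ ((hE e).mp he)
      rw [Set.encard_coe_eq_coe_finsetCard] at this
      exact_mod_cast this)
    (fun e he f hf hef => by
      refine Finset.card_le_one.mpr fun x hx y hy => ?_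
      rw [Finset.mem_inter] at hx hy
      by_contra hxy
      exact hef (Finset.coe_injective (hlin x ((hmemV x).mp (hEV e he hx.1)) y
        ((hmemV y).mp (hEV e he hy.1)) hxy _ ((hE e).mp he) _ ((hE f).mp hf) hx.1 hy.1 hx.2 hy.2)))
    (fun x hx y hy hxy => by
      obtain ⟨e, he, hxe, hye⟩ := hcomp x ((hmemV x).mp hx) y ((hmemV y).mp hy) hxy
      have heV : e ⊆ V := by
        rw [hV]
        exact G.subset_vertexSet_of_mem_edgeSet' he
      lift e to Finset α using V.finite_toSet.subset heV
      exact ⟨e, (hE e).mpr he, hxe, hye⟩)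
    (fun e => if h : (e : Set α) ∈ G.edgeSet then χ ⟨e, h⟩ else 0)
  refine ⟨Subtype.val ⁻¹' ((↑) '' (S : Set (Finset α))), ⟨?_, ?_⟩, c, ?_⟩
  · have hrange : ((↑) '' (S : Set (Finset α)) : Set (Set α)) ⊆
        Set.range (Subtype.val : G.edgeSet → Set α) := by
      rintro _ ⟨s, hs, rfl⟩
      exact ⟨⟨s, (hE s).mp (hSE hs)⟩, rfl⟩
    rw [← Subtype.val_injective.encard_image, Set.image_preimage_eq_of_subset hrange,
      Finset.coe_injective.encard_image, Set.encard_coe_eq_coe_finsetCard, hScard]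
  · refine (Set.encard_le_encard (t := ((S.biUnion id : Finset α) : Set α)) ?_).trans ?_
    · refine Set.iUnion₂_subset ?_
      rintro ⟨_, he⟩ ⟨s, hs, rfl⟩
      exact_mod_cast Finset.subset_biUnion_of_mem id hs
    · rw [Set.encard_coe_eq_coe_finsetCard]
      exact_mod_cast hS
  · rintro ⟨_, he⟩ ⟨s, hs, rfl⟩
    have := hc s hs
    rwa [dif_pos he] at this
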